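/- Let $\tau>0$, $\lambda_0,\lambda\in L^\infty(\mathbb R)$ (real-valued), $H=L^2(\mathbb R)$, and consider the linear delayed KdV--Burgers problem $$u_t+u_{xxx}-u_{xx}+\lambda_0(x)u(x,t)+\lambda(x)u(x,t-\tau)=0\ \text{ in }\mathbb R\times(0,\infty),\qquad u(x,s)=u_0(x,s)\ \text{ in }\mathbb R\times[-\tau,0],\tag{P}$$ with $u_0\in C([-\tau,0];H)$. A solution is a function $u\in C([-\tau,\infty);H)$ that equals $u_0$ on $[-\tau,0]$ and satisfies the equation weakly, i.e. for all $\varphi\in C_c^\infty(\mathbb R)$ and $t\ge0$ $$\int_{\mathbb R} u(t)\varphi\,dx=\int_{\mathbb R} u(0)\varphi\,dx+\int_0^t\!\Big(\int_{\mathbb R} u(s)(\varphi'''+\varphi''-\lambda_0\varphi)\,dx-\int_{\mathbb R}\lambda\,u(s-\tau)\varphi\,dx\Big)ds .$$ For $t\ge 0$ put $$\mathcal E(t)=\frac12\int_{\mathbb R}u^2(x,t)\,dx+\frac12\int_{t-\tau}^t\int_{\mathbb R}e^{-(t-s)}|\lambda(x)|u^2(x,s)\,dx\,ds,$$ $$C(u_0)=\frac12\|u_0(0)\|_2^2+\int_{-\tau}^0e^s\int_{\mathbb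 R}|\lambda(x)|u_0^2(x,s)\,dx\,ds,\qquad c_p=\Big(1-\frac1{2p}\Big)\Big(\frac2p\Big)^{\frac1{2p-1}}.$$ **Theorem 4.1.** Let $1\le p<\infty$, $\alpha_0>0$, $\beta_0\in L^p(\mathbb R)$ with $$\lambda_0(x)\ge\alpha_0-\beta_0(x)\ \text{ for a.e. }x\in\mathbb R,\qquad \|\beta_0\|_p<\Big(\frac{\alpha_0}{c_p}\Big)^{1-\frac1{2p}} .$$ Let $0\le\alpha<\alpha_0$ and $\beta\in L^p(\mathbb R)$ with $$\frac{e^\tau+1}2|\lambda(x)|\le\alpha+\beta(x)\ \text{ for a.e. }x\in\mathbb R,\qquad \|\beta_0+\beta\|_p<\Big(\frac{\alpha_0-\alpha}{c_p}\Big)^{1-\frac1{2p}} .$$ Then (P) is exponentially stable: there are constants $M,\kappa>0$, independent of the solution, such that $\|u(t)\|_2\le Me^{-\kappa t}\sup_{s\in[-\tau,0]}\|u_0(s)\|_2$ for all $u_0\in C([-\tau,0];H)$, all solutions $u$ of (P) and all $t\ge0$. More precisely, the number $$\tilde\gamma=\min\Big\{2\Big(\alpha_0-\alpha-\frac{2p-1}{2p}\Big(\frac2p\Big)^{\frac1{2p-1}}\|\beta+\beta_0\|_p^{\frac{2p}{2p-1}}\Big),1\Big\}$$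 is positive, and every solution of (P) with $u_0\in C([-\tau,0];H)$ satisfies, for all $t\ge0$, $$\mathcal E(t)\le\mathcal E(0)e^{-\tilde\gamma t}\qquad\text{and}\qquad\mathcal E(t)\le C(u_0)e^{-\tilde\gamma t}.$$ -/

import Mathlib

open MeasureTheory Set
open scoped ContDiff ENNReal

namespace KdVB

/-- The real Hilbert space `H = L²(ℝ)`. -/
abbrev H : Type := Lp ℝ 2 (volume : Measure ℝ)

/-- `u` is a solution, with history `u₀`, of the linear delayed KdV--Burgers problem
`u_t + u_xxx - u_xx + lam0 u + lam u(t - τ) = 0` on `ℝ × (0, ∞)`, `u = u₀` on `ℝ × [-τ, 0]`: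
`u ∈ C([-τ, ∞); H)`, it takes the prescribed history, and the equation holds weakly, i.e. after
multiplication by a test function `φ ∈ C_c^∞(ℝ)`, integration over `ℝ × (0, t)` and integration
by parts in `x`. Only the values of `u` on `[-τ, ∞)` and of `u₀` on `[-τ, 0]` matter. -/
structure IsSolution (τ : ℝ) (lam0 lam : ℝ → ℝ) (u₀ u : ℝ → H) : Prop where
  continuousOn : ContinuousOn u (Ici (-τ))
  history : ∀ s ∈ Icc (-τ) 0, u s = u₀ s
  weak : ∀ φ : ℝ → ℝ, ContDiff ℝ ∞ φ → HasCompactSupport φ → ∀ t : ℝ, 0 ≤ t →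
    (∫ x, u t x * φ x) = (∫ x, u 0 x * φ x) +
      ∫ s in (0 : ℝ)..t,
        ((∫ x, u s x * (iteratedDeriv 3 φ x + iteratedDeriv 2 φ x - lam0 x * φ x))
          - ∫ x, lam x * u (s - τ) x * φ x)

/-- The Lyapunov functional
`𝓔(t) = ½ ∫ u²(x,t) dx + ½ ∫_{t-τ}^t ∫ e^{-(t-s)} |lam(x)| u²(x,s) dx ds`. -/
noncomputable def energy (τ : ℝ) (lam : ℝ → ℝ) (u : ℝ → H) (t : ℝ) : ℝ :=
  1 / 2 * (∫ x, (u t x) ^ 2) +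
    1 / 2 * ∫ s in (t - τ)..t, ∫ x, Real.exp (-(t - s)) * |lam x| * (u s x) ^ 2

/-- `C(u₀) = ½ ‖u₀(0)‖₂² + ∫_{-τ}^0 e^s ∫ |lam(x)| u₀²(x,s) dx ds`. -/
noncomputable def initConst (τ : ℝ) (lam : ℝ → ℝ) (u₀ : ℝ → H) : ℝ :=
  1 / 2 * ‖u₀ 0‖ ^ 2 + ∫ s in (-τ)..0, Real.exp s * ∫ x, |lam x| * (u₀ s x) ^ 2

/-- `c_p = (1 - 1/(2p)) (2/p)^{1/(2p-1)}`. -/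
noncomputable def c (p : ℝ) : ℝ := (1 - 1 / (2 * p)) * (2 / p) ^ (1 / (2 * p - 1))

/-- The norm of `f` in `L^p(ℝ)`, as a real number; it is used for `f ∈ L^p(ℝ)` only. -/
noncomputable def normLp (p : ℝ) (f : ℝ → ℝ) : ℝ :=
  (eLpNorm f (ENNReal.ofReal p) volume).toReal

/-- The decay rate
`min {2 (α₀ - α - ((2p-1)/(2p)) (2/p)^{1/(2p-1)} ‖β + β₀‖_p^{2p/(2p-1)}), 1}`. -/
noncomputable def rate (p α₀ α : ℝ) (β₀ β : ℝ → ℝ) : ℝ :=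
  min (2 * (α₀ - α - (2 * p - 1) / (2 * p) * (2 / p) ^ (1 / (2 * p - 1)) *
    normLp p (β + β₀) ^ (2 * p / (2 * p - 1)))) 1

/-- Exponential stability: `‖u(t)‖_H ≤ M e^{-κt} ‖u₀‖_{C([-τ,0];H)}` for all solutions, with
constants `M, κ > 0` that do not depend on the solution. -/
def ExponentiallyStable (τ : ℝ) (lam0 lam : ℝ → ℝ) : Prop :=
  ∃ M κ : ℝ, 0 < M ∧ 0 < κ ∧ ∀ u₀ u : ℝ → H, ContinuousOn u₀ (Icc (-τ) 0) →
    IsSolution τ lam0 lam u₀ u → ∀ t : ℝ, 0 ≤ t →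
      ‖u t‖ ≤ M * Real.exp (-κ * t) * ⨆ s : Icc (-τ) (0 : ℝ), ‖u₀ s‖

end KdVB

namespace KdVB

open Filter Topology Function
open scoped Convolution RealInnerProductSpace

/-! Multiplying the equation by `u` removes `u_xxx` (antisymmetric) and turns `-u_xx` into the
dissipation `‖u_x‖²`. Young's inequality with weights `e^τ/2`, `e^{-τ}/2` splits the delay term;
differentiating the memory part of the energy cancels the delayed half and costs another `½ ∫ |lam|
u²`. What remains is a quadratic form with potential `h = (α₀ - α) - lam0 + (e^τ+1)/2 |lam| ≤ β +
β₀`. Hölder, Agmon and Young (`integral_mul_sq_le`) bound `∫ h u²` by `‖u_x‖²` plus a multiple `K`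
of `‖u‖²`; the dissipation absorbs the first term and the smallness of `‖β + β₀‖_p` makes `K < α₀ -
α`. Grönwall then gives the decay (`lyapunov_decay`).

A weak solution is only `L²` in space, so this computation is carried out for its mollifications,
which satisfy the equation classically in time (`mollify_eq_add_integral`). The dissipation is
eliminated before the mollifier is removed: since `h` is bounded, the surviving bound `rateBound` is
continuous on `L²`, and dominated convergence yields `sq_norm_sub_le_integral` with no `H¹`
regularity of `u`. -/

theorem inner_eq_integral (v w : H) : ⟪v, w⟫ = ∫ x, v x * w x := by
  rw [L2.inner_def]
  exact integral_congr_ae (.of_forall fun x => by simp [mul_comm])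

theorem inner_toLp (v : H) {f : ℝ → ℝ} (hf : MemLp f 2 volume) :
    ⟪v, hf.toLp f⟫ = ∫ x, v x * f x := by
  rw [inner_eq_integral]
  refine integral_congr_ae ?_
  filter_upwards [hf.coeFn_toLp] with x hx using by rw [hx]

theorem integrable_coe_mul (v : H) {f : ℝ → ℝ} (hf : MemLp f 2 volume) :
    Integrable (fun x => v x * f x) :=
  (Lp.memLp v).integrable_mul hf

theorem sq_norm_eq_integral (v : H) : ‖v‖ ^ 2 = ∫ x, v x ^ 2 := by
  rw [← real_inner_self_eq_norm_sq, inner_eq_integral]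
  simp only [pow_two]

/-! ### Translation and mollification on `H`. -/

/-- Translation of an `L²` function. -/
noncomputable def shift (z : ℝ) (v : H) : H := DomAddAct.mk z +ᵥ v

theorem shift_coe (z : ℝ) (v : H) : shift z v =ᵐ[volume] fun y => v (z + y) :=
  DomAddAct.vadd_Lp_ae_eq (DomAddAct.mk z) v

@[simp] theorem norm_shift (z : ℝ) (v : H) : ‖shift z v‖ = ‖v‖ :=
  DomAddAct.norm_vadd_Lp (DomAddAct.mk z) v

theorem shift_sub (z : ℝ) (v w : H) : shift z (v - w) = shift z v - shift z w :=
  DomAddAct.vadd_Lp_sub (DomAddAct.mk z) v w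

theorem shift_zero (v : H) : shift 0 v = v := by
  simp [shift]

theorem continuous_shift (v : H) : Continuous fun z => shift z v := by
  have : Fact ((2 : ℝ≥0∞) ≠ ⊤) := ⟨by simp⟩
  exact DomAddAct.continuous_mk.vadd continuous_const

theorem integrable_smul_shift {ψ : ℝ → ℝ} (hψ : Integrable ψ) (v : H) :
    Integrable fun z => ψ z • shift z v :=
  hψ.smul_bdd ‖v‖ (continuous_shift v).aestronglyMeasurable
    (.of_forall fun z => (norm_shift z v).le)

/-- The average `y ↦ ∫ ψ(z) v(y + z) dz` of the translates of `v`, as an element of `L²`. -/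
noncomputable def mollify (ψ : ℝ → ℝ) (v : H) : H := ∫ z, ψ z • shift z v

theorem mollify_sub {ψ : ℝ → ℝ} (hψ : Integrable ψ) (v w : H) :
    mollify ψ (v - w) = mollify ψ v - mollify ψ w := by
  simp only [mollify, shift_sub, smul_sub]
  exact integral_sub (integrable_smul_shift hψ v) (integrable_smul_shift hψ w)

theorem norm_mollify_le (ψ : ℝ → ℝ) (v : H) : ‖mollify ψ v‖ ≤ (∫ z, ‖ψ z‖) * ‖v‖ := by
  refine (norm_integral_le_integral_norm _).trans_eq ?_
  simp only [norm_smul, norm_shift]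
  exact integral_mul_const _ _

theorem continuous_mollify {ψ : ℝ → ℝ} (hψ : Integrable ψ) : Continuous (mollify ψ) := by
  refine (LipschitzWith.of_dist_le_mul (K := ⟨∫ z, ‖ψ z‖, by positivity⟩) fun v w => ?_).continuous
  rw [dist_eq_norm, dist_eq_norm, ← mollify_sub hψ]
  exact norm_mollify_le ψ _

theorem inner_mollify {ψ : ℝ → ℝ} (hψ : Integrable ψ) (v w : H) :
    ⟪mollify ψ v, w⟫ = ∫ z, ψ z * ⟪shift z v, w⟫ := by
  rw [real_inner_comm, mollify, ← integral_inner (integrable_smul_shift hψ v)]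
  simp only [real_inner_smul_right, real_inner_comm w]

/-- The orbit `z ↦ shift (-z) v` is continuous into `H`, and the mollification is its `H`-valued
convolution with an approximate identity, evaluated at `0`. -/
theorem tendsto_mollify_normed {ι : Type*} {l : Filter ι} {b : ι → ContDiffBump (0 : ℝ)}
    (hb : Tendsto (fun i => (b i).rOut) l (𝓝 0)) (v : H) :
    Tendsto (fun i => mollify ((b i).normed volume) v) l (𝓝 v) := by
  have h := ContDiffBump.convolution_tendsto_right_of_continuous (μ := (volume : Measure ℝ)) hb
    ((continuous_shift v).comp continuous_neg) 0
  simpa [shift_zero, mollify, convolution_def] using h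

theorem norm_mollify_normed_le (b : ContDiffBump (0 : ℝ)) (v : H) :
    ‖mollify (b.normed volume) v‖ ≤ ‖v‖ := by
  refine (norm_mollify_le _ v).trans_eq ?_
  simp only [Real.norm_of_nonneg (b.nonneg_normed _), b.integral_normed, one_mul]

/-- The continuous representative of `mollify ψ v`. -/
noncomputable def correlation (ψ : ℝ → ℝ) (v : ℝ → ℝ) (y : ℝ) : ℝ := ∫ x, ψ (x - y) * v x

theorem correlation_eq_convolution (ψ v : ℝ → ℝ) :
    correlation ψ v = v ⋆[ContinuousLinearMap.mul ℝ ℝ, volume] fun t => ψ (-t) := by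
  ext y
  simp [correlation, convolution_def, mul_comm]

theorem memLp_two_of_hasCompactSupport {φ : ℝ → ℝ} (hφ : Continuous φ) (h : HasCompactSupport φ) :
    MemLp φ 2 volume := hφ.memLp_of_hasCompactSupport h

theorem integral_norm_mul_le (v w : H) : ∫ x, ‖v x * w x‖ ≤ ‖v‖ * ‖w‖ := by
  have hv := (Lp.memLp v).norm
  have hw := (Lp.memLp w).norm
  have h := real_inner_le_norm (hv.toLp _) (hw.toLp _)
  rw [inner_toLp, Lp.norm_toLp, Lp.norm_toLp, eLpNorm_norm, eLpNorm_norm, ← Lp.norm_def,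
    ← Lp.norm_def] at h
  refine (integral_congr_ae ?_).trans_le h
  filter_upwards [hv.coeFn_toLp] with x hx
  rw [hx, norm_mul]

theorem integrable_prod_shift {ψ : ℝ → ℝ} (hψ : Integrable ψ) (v w : H) :
    Integrable (uncurry fun z y => ψ z * (v (z + y) * w y)) (volume.prod volume) := by
  have hm : AEStronglyMeasurable (uncurry fun z y => ψ z * (v (z + y) * w y))
      (volume.prod volume) := by
    refine hψ.aestronglyMeasurable.comp_fst.mul (StronglyMeasurable.aestronglyMeasurable ?_)
    exact ((Lp.stronglyMeasurable v).comp_measurable measurable_add).mul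
      ((Lp.stronglyMeasurable w).comp_measurable measurable_snd)
  have hae (z : ℝ) : (fun y => shift z v y * w y) =ᵐ[volume] fun y => v (z + y) * w y := by
    filter_upwards [shift_coe z v] with y hy using by rw [hy]
  refine (integrable_prod_iff hm).2 ⟨.of_forall fun z => ?_, ?_⟩
  · exact ((integrable_coe_mul _ (Lp.memLp w)).congr (hae z)).const_mul (ψ z)
  · refine (hψ.norm.mul_const (‖v‖ * ‖w‖)).mono' hm.norm.integral_prod_right' (.of_forall fun z => ?_)
    simp only [uncurry_apply_pair, norm_mul (ψ z)]
    rw [integral_const_mul, Real.norm_of_nonneg (by positivity)]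
    gcongr
    refine (integral_congr_ae ((hae z).symm.fun_comp norm)).trans_le ?_
    exact (integral_norm_mul_le _ _).trans_eq (by rw [norm_shift])

/-- Fubini, then the substitution `x = y + z`; this identifies the Bochner integral with a pointwise
formula. -/
theorem inner_mollify_eq_integral_correlation {ψ : ℝ → ℝ} (hψ : Integrable ψ) (v w : H) :
    ⟪mollify ψ v, w⟫ = ∫ y, correlation ψ v y * w y := by
  have h1 : ⟪mollify ψ v, w⟫ = ∫ z, ∫ y, ψ z * (v (z + y) * w y) := by
    rw [inner_mollify hψ]
    refine integral_congr_ae (.of_forall fun z => ?_)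
    simp only [integral_const_mul, inner_eq_integral]
    congr 1
    refine integral_congr_ae ?_
    filter_upwards [shift_coe z v] with y hy using by rw [hy]
  rw [h1, integral_integral_swap (integrable_prod_shift hψ v w)]
  refine integral_congr_ae (.of_forall fun y => ?_)
  simp only [correlation, ← mul_assoc, integral_mul_const]
  rw [← integral_add_right_eq_self (fun x => ψ (x - y) * v x) y]
  simp [add_comm]

theorem continuous_correlation {ψ : ℝ → ℝ} (hψ : Continuous ψ) (hs : HasCompactSupport ψ) (v : H) :
    Continuous (correlation ψ v) := by
  rw [correlation_eq_convolution]
  exact (hs.comp_homeomorph (Homeomorph.neg ℝ)).continuous_convolution_right _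
    ((Lp.memLp v).locallyIntegrable (by norm_num)) (hψ.comp continuous_neg)

theorem mollify_coe {ψ : ℝ → ℝ} (hψ : Continuous ψ) (hs : HasCompactSupport ψ) (v : H) :
    mollify ψ v =ᵐ[volume] correlation ψ v := by
  refine ae_eq_of_integral_contDiff_smul_eq ((Lp.memLp _).locallyIntegrable (by norm_num))
    (continuous_correlation hψ hs v).locallyIntegrable fun g hg hgs => ?_
  have hgL := memLp_two_of_hasCompactSupport hg.continuous hgs
  have h := inner_mollify_eq_integral_correlation (hψ.integrable_of_hasCompactSupport hs) v
    (hgL.toLp g)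
  rw [inner_toLp] at h
  simp only [smul_eq_mul, mul_comm (g _)]
  rw [h]
  refine integral_congr_ae ?_
  filter_upwards [hgL.coeFn_toLp] with x hx using by rw [hx]

theorem inner_shift_left (z : ℝ) (v w : H) : ⟪shift z v, w⟫ = ⟪v, shift (-z) w⟫ := by
  rw [inner_eq_integral, inner_eq_integral, ← integral_add_left_eq_self (fun x => v x * _) z]
  refine integral_congr_ae ?_
  filter_upwards [shift_coe z v, (quasiMeasurePreserving_add_left volume z).ae (shift_coe (-z) w)]
    with x h1 h2
  rw [h1, h2, neg_add_cancel_left]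

/-- The adjoint of mollification by `ψ` is mollification by the reflected kernel, whose action on
`φ` is `φ ⋆ ψ`. -/
theorem inner_mollify_toLp {ψ φ : ℝ → ℝ} (hψ : Continuous ψ) (hs : HasCompactSupport ψ)
    (hφ : MemLp φ 2 volume) (v : H) :
    ⟪mollify ψ v, hφ.toLp φ⟫ = ∫ x, v x * (φ ⋆[ContinuousLinearMap.mul ℝ ℝ, volume] ψ) x := by
  have hs' : HasCompactSupport fun z => ψ (-z) := hs.comp_homeomorph (Homeomorph.neg ℝ)
  have hψ' : Continuous fun z => ψ (-z) := hψ.comp continuous_neg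
  have h1 : ⟪mollify ψ v, hφ.toLp φ⟫ = ⟪v, mollify (fun z => ψ (-z)) (hφ.toLp φ)⟫ := by
    rw [real_inner_comm _ v, inner_mollify (hψ.integrable_of_hasCompactSupport hs),
      inner_mollify (hψ'.integrable_of_hasCompactSupport hs'), ← integral_neg_eq_self]
    simp only [inner_shift_left (-_), neg_neg, real_inner_comm]
  rw [h1, inner_eq_integral]
  refine integral_congr_ae ?_
  filter_upwards [mollify_coe hψ' hs' (hφ.toLp φ)] with x hx
  rw [hx, correlation, convolution_def]
  congr 1
  refine integral_congr_ae ?_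
  filter_upwards [hφ.coeFn_toLp] with t ht
  simp [ht, mul_comm]

/-! ### Space derivatives of mollified functions. -/

theorem hasCompactSupport_iteratedDeriv {ψ : ℝ → ℝ} (hs : HasCompactSupport ψ) (k : ℕ) :
    HasCompactSupport (iteratedDeriv k ψ) := by
  induction k with
  | zero => simpa using hs
  | succ k ih => rw [iteratedDeriv_succ]; exact ih.deriv

theorem contDiff_iteratedDeriv {ψ : ℝ → ℝ} (hψ : ContDiff ℝ ∞ ψ) (k : ℕ) :
    ContDiff ℝ ∞ (iteratedDeriv k ψ) := by
  induction k with
  | zero => simpa using hψ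
  | succ k ih => rw [iteratedDeriv_succ]; exact (contDiff_infty_iff_deriv.1 ih).2

theorem iteratedDeriv_convolution {ψ φ : ℝ → ℝ} (hψ : ContDiff ℝ ∞ ψ) (hs : HasCompactSupport ψ)
    (hφ : LocallyIntegrable φ) (k : ℕ) :
    iteratedDeriv k (φ ⋆[ContinuousLinearMap.mul ℝ ℝ, volume] ψ) =
      φ ⋆[ContinuousLinearMap.mul ℝ ℝ, volume] iteratedDeriv k ψ := by
  induction k with
  | zero => simp
  | succ k ih =>
    ext x
    rw [iteratedDeriv_succ, ih, iteratedDeriv_succ]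
    exact (HasCompactSupport.hasDerivAt_convolution_right _ hφ (hasCompactSupport_iteratedDeriv hs k)
      ((contDiff_iteratedDeriv hψ k).of_le (by simp)) x).deriv

/-- The kernel enters as `ψ (x - y)`, so each derivative in `y` brings a minus sign: `mollify
(iteratedDeriv k ψ) v` stands for `(-1)^k` times the `k`-th derivative of `mollify ψ v`. -/
theorem hasDerivAt_correlation {ψ : ℝ → ℝ} (hψ : ContDiff ℝ ∞ ψ) (hs : HasCompactSupport ψ)
    (v : H) (k : ℕ) (y : ℝ) :
    HasDerivAt (correlation (iteratedDeriv k ψ) v) (-correlation (iteratedDeriv (k + 1) ψ) v y) y := by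
  have hs' : HasCompactSupport fun t => iteratedDeriv k ψ (-t) :=
    (hasCompactSupport_iteratedDeriv hs k).comp_homeomorph (Homeomorph.neg ℝ)
  have hc : ContDiff ℝ 1 (fun t => iteratedDeriv k ψ (-t)) :=
    ((contDiff_iteratedDeriv hψ k).comp contDiff_neg).of_le (by simp)
  have hd : deriv (fun t => iteratedDeriv k ψ (-t)) = fun t => -iteratedDeriv (k + 1) ψ (-t) := by
    ext t
    rw [deriv_comp_neg, iteratedDeriv_succ]
  have h := HasCompactSupport.hasDerivAt_convolution_right (ContinuousLinearMap.mul ℝ ℝ)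
    ((Lp.memLp v).locallyIntegrable (by norm_num)) hs' hc y
  rw [correlation_eq_convolution]
  rw [hd] at h
  refine h.congr_deriv ?_
  rw [correlation, convolution_def, ← integral_neg]
  simp [mul_comm]

theorem mollify_iteratedDeriv_coe (hψ : ContDiff ℝ ∞ ψ) (hs : HasCompactSupport ψ) (v : H) (k : ℕ) :
    mollify (iteratedDeriv k ψ) v =ᵐ[volume] correlation (iteratedDeriv k ψ) v :=
  mollify_coe (contDiff_iteratedDeriv hψ k).continuous (hasCompactSupport_iteratedDeriv hs k) v

theorem memLp_correlation_iteratedDeriv (hψ : ContDiff ℝ ∞ ψ) (hs : HasCompactSupport ψ) (v : H)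
    (k : ℕ) : MemLp (correlation (iteratedDeriv k ψ) v) 2 volume :=
  (memLp_congr_ae (mollify_iteratedDeriv_coe hψ hs v k)).1 (Lp.memLp _)

/-- Integration by parts on the line; integrability of the product removes the boundary terms. -/
theorem inner_mollify_iteratedDeriv_succ (hψ : ContDiff ℝ ∞ ψ) (hs : HasCompactSupport ψ) (v : H)
    (j k : ℕ) : ⟪mollify (iteratedDeriv (j + 1) ψ) v, mollify (iteratedDeriv k ψ) v⟫ =
      -⟪mollify (iteratedDeriv j ψ) v, mollify (iteratedDeriv (k + 1) ψ) v⟫ := by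
  have hinner (i l : ℕ) : ⟪mollify (iteratedDeriv i ψ) v, mollify (iteratedDeriv l ψ) v⟫ =
      ∫ y, correlation (iteratedDeriv i ψ) v y * correlation (iteratedDeriv l ψ) v y := by
    rw [inner_eq_integral]
    refine integral_congr_ae ?_
    filter_upwards [mollify_iteratedDeriv_coe hψ hs v i, mollify_iteratedDeriv_coe hψ hs v l]
      with y h1 h2
    rw [h1, h2]
  have hint (i l : ℕ) : Integrable fun y =>
      correlation (iteratedDeriv i ψ) v y * correlation (iteratedDeriv l ψ) v y :=
    (memLp_correlation_iteratedDeriv hψ hs v i).integrable_mul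
      (memLp_correlation_iteratedDeriv hψ hs v l)
  have h := integral_mul_deriv_eq_deriv_mul_of_integrable
    (fun y _ => hasDerivAt_correlation hψ hs v j y) (fun y _ => hasDerivAt_correlation hψ hs v k y)
    (by simpa [Pi.mul_def] using (hint j (k + 1)).neg)
    (by simpa [Pi.mul_def] using (hint (j + 1) k).neg) (hint j k)
  simp only [mul_neg, neg_mul, integral_neg, neg_neg] at h
  rw [hinner, hinner, h]

theorem inner_mollify_second_deriv (hψ : ContDiff ℝ ∞ ψ) (hs : HasCompactSupport ψ) (v : H) :
    ⟪mollify (iteratedDeriv 2 ψ) v, mollify ψ v⟫ = -‖mollify (iteratedDeriv 1 ψ) v‖ ^ 2 := by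
  have h := inner_mollify_iteratedDeriv_succ hψ hs v 1 0
  rwa [iteratedDeriv_zero, zero_add, real_inner_self_eq_norm_sq] at h

/-- Two integrations by parts show that the pairing of the second and first derivatives equals its
own negative. -/
theorem inner_mollify_third_deriv (hψ : ContDiff ℝ ∞ ψ) (hs : HasCompactSupport ψ) (v : H) :
    ⟪mollify (iteratedDeriv 3 ψ) v, mollify ψ v⟫ = 0 := by
  have h := inner_mollify_iteratedDeriv_succ hψ hs v 2 0
  have h' := inner_mollify_iteratedDeriv_succ hψ hs v 1 1
  rw [iteratedDeriv_zero, zero_add] at h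
  norm_num at h h'
  have hc := real_inner_comm (mollify (deriv ψ) v) (mollify (iteratedDeriv 2 ψ) v)
  linarith

/-! ### The interpolation inequality. -/

/-- Agmon's inequality on the line. -/
theorem sq_le_two_mul_sqrt_mul_sqrt {f f' : ℝ → ℝ} (hf : MemLp f 2 volume)
    (hf' : MemLp f' 2 volume) (hd : ∀ y, HasDerivAt f (f' y) y) (y : ℝ) :
    f y ^ 2 ≤ 2 * (Real.sqrt (∫ x, f x ^ 2) * Real.sqrt (∫ x, f' x ^ 2)) := by
  have hint : Integrable fun x => 2 * (f x * f' x) := (hf.integrable_mul hf').const_mul 2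
  have hd2 (x : ℝ) : HasDerivAt (fun x => f x ^ 2) (2 * (f x * f' x)) x := by
    exact ((hd x).fun_pow 2).congr_deriv (by push_cast; ring)
  -- A function that is integrable together with its derivative vanishes at `-∞`. Integrating from
  -- that side only gives the constant `2`, the source of `2/p` in `c p`.
  have h0 : Tendsto (fun x => f x ^ 2) atBot (𝓝 0) :=
    tendsto_zero_of_hasDerivAt_of_integrableOn_Iic (a := 0) (fun x _ => hd2 x)
      hint.integrableOn hf.integrable_sq.integrableOn
  have h1 := integral_Iic_of_hasDerivAt_of_tendsto' (a := y) (fun x _ => hd2 x) hint.integrableOn h0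
  rw [sub_zero] at h1
  have hCS : ∫ x, ‖f x‖ * ‖f' x‖ ≤ Real.sqrt (∫ x, f x ^ 2) * Real.sqrt (∫ x, f' x ^ 2) := by
    have h := integral_mul_norm_le_Lp_mul_Lq (μ := volume) (f := f) (g := f')
      Real.HolderConjugate.two_two (by simpa using hf) (by simpa using hf')
    simpa [Real.sqrt_eq_rpow] using h
  calc f y ^ 2 = ∫ x in Iic y, 2 * (f x * f' x) := h1.symm
    _ ≤ ∫ x in Iic y, ‖2 * (f x * f' x)‖ :=
      setIntegral_mono hint.integrableOn hint.norm.integrableOn fun x => Real.le_norm_self _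
    _ ≤ ∫ x, ‖2 * (f x * f' x)‖ :=
      setIntegral_le_integral hint.norm (.of_forall fun x => norm_nonneg _)
    _ = 2 * ∫ x, ‖f x‖ * ‖f' x‖ := by
      rw [← integral_const_mul]
      simp only [norm_mul, Real.norm_two]
    _ ≤ _ := by gcongr

/-- Young's inequality with the constant of the interpolation estimate. -/
theorem rpow_mul_rpow_le_add {p : ℝ} (hp : 1 ≤ p) {G A B : ℝ} (hG : 0 ≤ G) (hA : 0 ≤ A)
    (hB : 0 ≤ B) :
    G * (2 * (Real.sqrt A * Real.sqrt B)) ^ (1 / p) * A ^ (1 - 1 / p) ≤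
      B + (2 * p - 1) / (2 * p) * (2 / p) ^ (1 / (2 * p - 1)) * G ^ (2 * p / (2 * p - 1)) * A := by
  have hp0 : 0 < p := by linarith
  have h2p : 0 < 2 * p - 1 := by linarith
  -- With weights `1/(2p)` and `(2p-1)/(2p)` on `2pB` and `KA`, `B` comes out with coefficient
  -- exactly `1`, the dissipation available. The factor `4` inside the power splits as `2p · (2/p)`,
  -- which fixes `K`.
  set K := (2 / p) ^ (1 / (2 * p - 1)) * G ^ (2 * p / (2 * p - 1)) with hK
  have hK0 : 0 ≤ K := by positivity
  have hy := Real.geom_mean_le_arith_mean2_weighted (w₁ := 1 / (2 * p))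
    (w₂ := (2 * p - 1) / (2 * p)) (p₁ := 2 * p * B) (p₂ := K * A) (by positivity) (by positivity)
    (by positivity) (by positivity) (by field_simp; ring)
  refine le_trans (le_of_eq ?_) (hy.trans_eq ?_)
  · have e1 : 1 - 1 / p = (2 * p - 1) / (2 * p) - 1 / (2 * p) := by field_simp; ring
    have hKp : K ^ ((2 * p - 1) / (2 * p)) = (2 / p) ^ (1 / (2 * p)) * G := by
      rw [hK, Real.mul_rpow (by positivity) (by positivity), ← Real.rpow_mul (by positivity),
        ← Real.rpow_mul hG]
      have a1 : 1 / (2 * p - 1) * ((2 * p - 1) / (2 * p)) = 1 / (2 * p) := by field_simp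
      have a2 : 2 * p / (2 * p - 1) * ((2 * p - 1) / (2 * p)) = 1 := by field_simp
      rw [a1, a2, Real.rpow_one]
    have h4 : (2 * (Real.sqrt A * Real.sqrt B)) ^ (1 / p) = (4 * (A * B)) ^ (1 / (2 * p)) := by
      have : 2 * (Real.sqrt A * Real.sqrt B) = (4 * (A * B)) ^ (1 / 2 : ℝ) := by
        rw [← Real.sqrt_eq_rpow, Real.sqrt_mul (by norm_num), Real.sqrt_mul hA,
          show (4 : ℝ) = 2 ^ 2 by norm_num, Real.sqrt_sq (by norm_num)]
      rw [this, ← Real.rpow_mul (by positivity)]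
      congr 1
      field_simp
    rw [h4, Real.mul_rpow (by positivity) hB, Real.mul_rpow hK0 hA, hKp]
    have hA2 : A ^ ((2 * p - 1) / (2 * p)) = A ^ (1 / (2 * p)) * A ^ (1 - 1 / p) := by
      rw [← Real.rpow_add_of_nonneg hA (by positivity) (by
        rw [sub_nonneg, div_le_one hp0]; exact hp)]
      congr 1
      field_simp; ring
    rw [hA2, Real.mul_rpow (by norm_num) (by positivity), Real.mul_rpow hA hB]
    have h4' : (4 : ℝ) ^ (1 / (2 * p)) = (2 * p) ^ (1 / (2 * p)) * (2 / p) ^ (1 / (2 * p)) := by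
      rw [← Real.mul_rpow (by positivity) (by positivity)]
      congr 1
      field_simp; norm_num
    rw [h4']
    ring
  · rw [hK]
    field_simp

/-- Interpolation: the potential energy of an `L^p` potential is controlled by the kinetic energy. -/
theorem integral_mul_sq_le {p : ℝ} (hp : 1 ≤ p) {g h f f' : ℝ → ℝ}
    (hg : MemLp g (ENNReal.ofReal p) volume) (hhg : ∀ᵐ x, h x ≤ g x)
    (hf : MemLp f 2 volume) (hf' : MemLp f' 2 volume) (hd : ∀ y, HasDerivAt f (f' y) y) :
    ∫ x, h x * f x ^ 2 ≤ (∫ x, f' x ^ 2) +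
      (2 * p - 1) / (2 * p) * (2 / p) ^ (1 / (2 * p - 1)) * normLp p g ^ (2 * p / (2 * p - 1)) *
        ∫ x, f x ^ 2 := by
  have hp0 : 0 < p := by linarith
  have hA : 0 ≤ ∫ x, f x ^ 2 := integral_nonneg fun x => by positivity
  have hB : 0 ≤ ∫ x, f' x ^ 2 := integral_nonneg fun x => by positivity
  refine le_trans ?_ (rpow_mul_rpow_le_add hp ENNReal.toReal_nonneg hA hB)
  set S := 2 * (Real.sqrt (∫ x, f x ^ 2) * Real.sqrt (∫ x, f' x ^ 2)) with hS
  have hS0 : 0 ≤ S := by positivity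
  have hG : 0 ≤ normLp p g := ENNReal.toReal_nonneg
  have hp' : 0 ≤ 1 - 1 / p := by rw [sub_nonneg, div_le_one hp0]; exact hp
  have hpt (x : ℝ) : f x ^ 2 ≤ S := sq_le_two_mul_sqrt_mul_sqrt hf hf' hd x
  have hAe : ∫⁻ x, ENNReal.ofReal (f x ^ 2) = ENNReal.ofReal (∫ x, f x ^ 2) :=
    (ofReal_integral_eq_lintegral_ofReal hf.integrable_sq (.of_forall fun x => sq_nonneg _)).symm
  have hGe : (∫⁻ x, ‖g x‖ₑ ^ p) ^ (1 / p) = ENNReal.ofReal (normLp p g) := by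
    rw [normLp, ENNReal.ofReal_toReal hg.eLpNorm_ne_top,
      eLpNorm_eq_lintegral_rpow_enorm_toReal (by simpa using hp0) (by simp),
      ENNReal.toReal_ofReal hp0.le]
  -- The part `(f²)^(1/p)` is bounded by its supremum, and Hölder with weights `1/p`, `1 - 1/p`
  -- handles the rest; `p = 1` needs no separate case.
  have key : ∫⁻ x, ENNReal.ofReal (h x * f x ^ 2) ≤
      ENNReal.ofReal (normLp p g * S ^ (1 / p) * (∫ x, f x ^ 2) ^ (1 - 1 / p)) := by
    calc ∫⁻ x, ENNReal.ofReal (h x * f x ^ 2)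
        ≤ ∫⁻ x, ENNReal.ofReal (S ^ (1 / p)) *
            ((‖g x‖ₑ ^ p) ^ (1 / p) * ENNReal.ofReal (f x ^ 2) ^ (1 - 1 / p)) := by
          refine lintegral_mono_ae ?_
          filter_upwards [hhg] with x hx
          rw [← ENNReal.rpow_mul, mul_one_div_cancel hp0.ne', ENNReal.rpow_one,
            ENNReal.ofReal_rpow_of_nonneg (sq_nonneg _) hp', ← ofReal_norm,
            ← ENNReal.ofReal_mul (norm_nonneg _), ← ENNReal.ofReal_mul (by positivity)]
          refine ENNReal.ofReal_le_ofReal ?_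
          have e : f x ^ 2 = (f x ^ 2) ^ (1 / p) * (f x ^ 2) ^ (1 - 1 / p) := by
            rw [← Real.rpow_add_of_nonneg (sq_nonneg _) (by positivity) hp']
            simp
          calc h x * f x ^ 2 ≤ ‖g x‖ * f x ^ 2 := by
                gcongr
                exact hx.trans (Real.le_norm_self _)
            _ = (f x ^ 2) ^ (1 / p) * (‖g x‖ * (f x ^ 2) ^ (1 - 1 / p)) := by
                nth_rw 1 [e]; ring
            _ ≤ _ := by
                gcongr
                exact hpt x
      _ = ENNReal.ofReal (S ^ (1 / p)) *
            ∫⁻ x, (‖g x‖ₑ ^ p) ^ (1 / p) * ENNReal.ofReal (f x ^ 2) ^ (1 - 1 / p) :=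
          lintegral_const_mul' _ _ ENNReal.ofReal_ne_top
      _ ≤ ENNReal.ofReal (S ^ (1 / p)) *
            ((∫⁻ x, ‖g x‖ₑ ^ p) ^ (1 / p) * (∫⁻ x, ENNReal.ofReal (f x ^ 2)) ^ (1 - 1 / p)) := by
          gcongr
          exact ENNReal.lintegral_mul_norm_pow_le (hg.aestronglyMeasurable.enorm.pow_const p)
            (hf.aestronglyMeasurable.aemeasurable.pow_const 2).ennreal_ofReal (by positivity) hp'
            (by ring)
      _ = _ := by
          rw [hAe, hGe, ENNReal.ofReal_rpow_of_nonneg hA hp', ← ENNReal.ofReal_mul hG,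
            ← ENNReal.ofReal_mul (by positivity)]
          congr 1
          ring
  -- Without integrability the left integral is `0` by convention, and the right side is
  -- nonnegative.
  by_cases hi : Integrable fun x => h x * f x ^ 2
  · rw [integral_eq_lintegral_pos_part_sub_lintegral_neg_part hi]
    refine (sub_le_self _ ENNReal.toReal_nonneg).trans ?_
    exact ENNReal.toReal_le_of_le_ofReal (by positivity) key
  · rw [integral_undef hi]
    change 0 ≤ normLp p g * _ * _
    positivity

/-! ### Bounded multipliers, and identification of `L²` functions by testing. -/

/-- Multiplication by an essentially bounded function, as a bounded operator on `L²`. -/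
noncomputable def mulL {m : ℝ → ℝ} (hm : MemLp m ⊤ volume) : H →L[ℝ] H :=
  (ContinuousLinearMap.mul ℝ ℝ).holderL volume ⊤ 2 2 (hm.toLp m)

theorem mulL_coe {m : ℝ → ℝ} (hm : MemLp m ⊤ volume) (v : H) :
    mulL hm v =ᵐ[volume] fun x => m x * v x := by
  have h := (ContinuousLinearMap.mul ℝ ℝ).coeFn_holder (r := 2) (hm.toLp m) v
  filter_upwards [h, hm.coeFn_toLp] with x h1 h2
  exact h1.trans (by simp [h2])

theorem inner_mulL {m : ℝ → ℝ} (hm : MemLp m ⊤ volume) (v w : H) :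
    ⟪mulL hm v, w⟫ = ∫ x, m x * v x * w x := by
  rw [inner_eq_integral]
  refine integral_congr_ae ?_
  filter_upwards [mulL_coe hm v] with x hx using by rw [hx]

theorem integrable_mulL {m : ℝ → ℝ} (hm : MemLp m ⊤ volume) (v w : H) :
    Integrable fun x => m x * v x * w x := by
  refine (integrable_coe_mul (mulL hm v) (Lp.memLp w)).congr ?_
  filter_upwards [mulL_coe hm v] with x hx using by rw [hx]

theorem eq_of_inner_toLp {v w : H} (h : ∀ φ : ℝ → ℝ, ContDiff ℝ ∞ φ → HasCompactSupport φ →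
    ∀ hφ : MemLp φ 2 volume, ⟪v, hφ.toLp φ⟫ = ⟪w, hφ.toLp φ⟫) : v = w := by
  refine Lp.ext (ae_eq_of_integral_contDiff_smul_eq ((Lp.memLp _).locallyIntegrable (by norm_num))
    ((Lp.memLp _).locallyIntegrable (by norm_num)) fun g hg hgs => ?_)
  have := h g hg hgs (memLp_two_of_hasCompactSupport hg.continuous hgs)
  simpa only [inner_toLp, smul_eq_mul, mul_comm] using this

/-! ### The mollified equation and the energy inequality. -/

section Evolution

variable {τ : ℝ} {lam0 lam : ℝ → ℝ} {u₀ u : ℝ → H}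

/-- The lower order terms of the equation. -/
noncomputable def source (τ : ℝ) (h0 : MemLp lam0 ⊤ volume) (h1 : MemLp lam ⊤ volume)
    (u : ℝ → H) (s : ℝ) : H :=
  -mulL h0 (u s) - mulL h1 (u (s - τ))

theorem continuous_source (h0 : MemLp lam0 ⊤ volume) (h1 : MemLp lam ⊤ volume)
    (hu : Continuous u) : Continuous (source τ h0 h1 u) := by
  unfold source
  fun_prop

/-- The time derivative of `mollify ψ (u s)`. -/
noncomputable def mollifiedDrift (τ : ℝ) (h0 : MemLp lam0 ⊤ volume) (h1 : MemLp lam ⊤ volume)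
    (u : ℝ → H) (ψ : ℝ → ℝ) (s : ℝ) : H :=
  mollify (iteratedDeriv 3 ψ) (u s) + mollify (iteratedDeriv 2 ψ) (u s) +
    mollify ψ (source τ h0 h1 u s)

theorem integrable_iteratedDeriv {ψ : ℝ → ℝ} (hψ : ContDiff ℝ ∞ ψ) (hs : HasCompactSupport ψ)
    (k : ℕ) : Integrable (iteratedDeriv k ψ) :=
  (contDiff_iteratedDeriv hψ k).continuous.integrable_of_hasCompactSupport
    (hasCompactSupport_iteratedDeriv hs k)

theorem continuous_mollifiedDrift (h0 : MemLp lam0 ⊤ volume) (h1 : MemLp lam ⊤ volume)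
    (hu : Continuous u) {ψ : ℝ → ℝ} (hψ : ContDiff ℝ ∞ ψ) (hs : HasCompactSupport ψ) :
    Continuous (mollifiedDrift τ h0 h1 u ψ) := by
  have hi := integrable_iteratedDeriv hψ hs
  have h := continuous_mollify (hi 0)
  rw [iteratedDeriv_zero] at h
  exact (((continuous_mollify (hi 3)).comp hu).add ((continuous_mollify (hi 2)).comp hu)).add
    (h.comp (continuous_source h0 h1 hu))

/-- Testing the mollified equation with `φ` amounts to testing the weak one with `φ ⋆ ψ`. The result
is an identity in `H` with continuous integrand, hence differentiability in time. -/
theorem mollify_eq_add_integral (h0 : MemLp lam0 ⊤ volume) (h1 : MemLp lam ⊤ volume)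
    (hu : Continuous u) (hsol : IsSolution τ lam0 lam u₀ u) {ψ : ℝ → ℝ} (hψ : ContDiff ℝ ∞ ψ)
    (hs : HasCompactSupport ψ) {t : ℝ} (ht : 0 ≤ t) :
    mollify ψ (u t) = mollify ψ (u 0) + ∫ s in (0 : ℝ)..t, mollifiedDrift τ h0 h1 u ψ s := by
  refine eq_of_inner_toLp fun φ hφ hφs hφL => ?_
  set Φ := φ ⋆[ContinuousLinearMap.mul ℝ ℝ, volume] ψ with hΦ
  have hφloc : LocallyIntegrable φ := hφ.continuous.locallyIntegrable
  have hΦd : ContDiff ℝ ∞ Φ := hs.contDiff_convolution_right _ hφloc hψ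
  have hΦs : HasCompactSupport Φ := hφs.convolution _ hs
  have hΦk (k : ℕ) : MemLp (iteratedDeriv k Φ) 2 volume := memLp_two_of_hasCompactSupport
    (contDiff_iteratedDeriv hΦd k).continuous (hasCompactSupport_iteratedDeriv hΦs k)
  have hΦL : MemLp Φ 2 volume := by simpa using hΦk 0
  have hinner (k : ℕ) (v : H) : ⟪mollify (iteratedDeriv k ψ) v, hφL.toLp φ⟫ =
      ∫ x, v x * iteratedDeriv k Φ x := by
    rw [iteratedDeriv_convolution hψ hs hφloc, inner_mollify_toLp
      (contDiff_iteratedDeriv hψ k).continuous (hasCompactSupport_iteratedDeriv hs k)]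
  have hinner0 (v : H) : ⟪mollify ψ v, hφL.toLp φ⟫ = ∫ x, v x * Φ x :=
    inner_mollify_toLp hψ.continuous hs hφL v
  have hmul {m : ℝ → ℝ} (hm : MemLp m ⊤ volume) (v : H) :
      (fun x => m x * v x * Φ x) =ᵐ[volume] fun x => mulL hm v x * Φ x := by
    filter_upwards [mulL_coe hm v] with x hx using by rw [hx]
  have hdrift (s : ℝ) : ⟪mollifiedDrift τ h0 h1 u ψ s, hφL.toLp φ⟫ =
      (∫ x, u s x * (iteratedDeriv 3 Φ x + iteratedDeriv 2 Φ x - lam0 x * Φ x))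
          - ∫ x, lam x * u (s - τ) x * Φ x := by
    have e1 : ∫ x, u s x * (iteratedDeriv 3 Φ x + iteratedDeriv 2 Φ x - lam0 x * Φ x) =
        (∫ x, u s x * iteratedDeriv 3 Φ x) + (∫ x, u s x * iteratedDeriv 2 Φ x) -
          ⟪mulL h0 (u s), hΦL.toLp Φ⟫ := by
      have hi := (integrable_coe_mul (mulL h0 (u s)) hΦL).congr (hmul h0 (u s)).symm
      have i3 := integrable_coe_mul (u s) (hΦk 3)
      have i2 := integrable_coe_mul (u s) (hΦk 2)
      rw [inner_toLp, ← integral_congr_ae (hmul h0 (u s)), ← integral_add i3 i2,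
        ← integral_sub (i3.fun_add i2) hi]
      refine integral_congr_ae (.of_forall fun x => ?_)
      simp only
      ring
    have e2 : ∫ x, lam x * u (s - τ) x * Φ x = ⟪mulL h1 (u (s - τ)), hΦL.toLp Φ⟫ := by
      rw [inner_toLp, integral_congr_ae (hmul h1 (u (s - τ)))]
    have e3 : ⟪mollify ψ (source τ h0 h1 u s), hφL.toLp φ⟫ =
        ⟪source τ h0 h1 u s, hΦL.toLp Φ⟫ := by rw [hinner0, inner_toLp]
    rw [mollifiedDrift, inner_add_left, inner_add_left, hinner, hinner, e3, e1, e2, source,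
      inner_sub_left, inner_neg_left]
    ring
  have hcont := continuous_mollifiedDrift (τ := τ) h0 h1 hu hψ hs
  rw [inner_add_left, hinner0, hinner0, hsol.weak Φ hΦd hΦs t ht]
  congr 1
  rw [real_inner_comm]
  have hcomm := (innerSL ℝ (hφL.toLp φ)).intervalIntegral_comp_comm
    (hcont.intervalIntegrable (μ := volume) 0 t)
  simp only [innerSL_apply_apply] at hcomm
  rw [← hcomm]
  refine intervalIntegral.integral_congr fun s _ => ?_
  simp only [real_inner_comm _ (hφL.toLp φ)]
  exact (hdrift s).symm

theorem sq_norm_mollify_sub (h0 : MemLp lam0 ⊤ volume) (h1 : MemLp lam ⊤ volume)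
    (hu : Continuous u) (hsol : IsSolution τ lam0 lam u₀ u) {ψ : ℝ → ℝ} (hψ : ContDiff ℝ ∞ ψ)
    (hs : HasCompactSupport ψ) {r t : ℝ} (hr : 0 ≤ r) (hrt : r ≤ t) :
    ‖mollify ψ (u t)‖ ^ 2 - ‖mollify ψ (u r)‖ ^ 2 =
      ∫ s in r..t, 2 * (-‖mollify (iteratedDeriv 1 ψ) (u s)‖ ^ 2 +
        ⟪mollify ψ (u s), mollify ψ (source τ h0 h1 u s)⟫) := by
  have hcont := continuous_mollifiedDrift (τ := τ) h0 h1 hu hψ hs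
  have hi := integrable_iteratedDeriv hψ hs
  have hψi : Integrable ψ := by simpa using hi 0
  have hcm := (continuous_mollify hψi).comp hu
  have hcs := (continuous_mollify hψi).comp (continuous_source (τ := τ) h0 h1 hu)
  have hc1 := (continuous_mollify (hi 1)).comp hu
  symm
  refine intervalIntegral.integral_eq_sub_of_hasDerivAt_of_le hrt
    (f := fun s => ‖mollify ψ (u s)‖ ^ 2) (hcm.norm.pow 2).continuousOn (fun s hs' => ?_)
    (Continuous.intervalIntegrable (by simp only [comp_def] at *; fun_prop) _ _)
  have hd : HasDerivAt (fun s => mollify ψ (u s)) (mollifiedDrift τ h0 h1 u ψ s) s := by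
    have h := (intervalIntegral.integral_hasDerivAt_right (hcont.intervalIntegrable 0 s)
      (hcont.stronglyMeasurableAtFilter _ _) hcont.continuousAt).const_add (mollify ψ (u 0))
    refine h.congr_of_eventuallyEq ?_
    filter_upwards [lt_mem_nhds (hr.trans_lt hs'.1)] with z hz
    exact mollify_eq_add_integral h0 h1 hu hsol hψ hs hz.le
  refine hd.norm_sq.congr_deriv ?_
  rw [mollifiedDrift, inner_add_right, inner_add_right, real_inner_comm,
    inner_mollify_third_deriv hψ hs, real_inner_comm, inner_mollify_second_deriv hψ hs, zero_add]

theorem inner_mulL_mollify_le {p : ℝ} (hp : 1 ≤ p) {g h : ℝ → ℝ}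
    (hg : MemLp g (ENNReal.ofReal p) volume) (hh : MemLp h ⊤ volume) (hhg : ∀ᵐ x, h x ≤ g x)
    {ψ : ℝ → ℝ} (hψ : ContDiff ℝ ∞ ψ) (hs : HasCompactSupport ψ) (v : H) :
    ⟪mulL hh (mollify ψ v), mollify ψ v⟫ ≤ ‖mollify (iteratedDeriv 1 ψ) v‖ ^ 2 +
      (2 * p - 1) / (2 * p) * (2 / p) ^ (1 / (2 * p - 1)) * normLp p g ^ (2 * p / (2 * p - 1)) *
        ‖mollify ψ v‖ ^ 2 := by
  have hd (y : ℝ) := hasDerivAt_correlation hψ hs v 0 y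
  have hL0 := memLp_correlation_iteratedDeriv hψ hs v 0
  have hc0 := mollify_iteratedDeriv_coe hψ hs v 0
  have hc1 := mollify_iteratedDeriv_coe hψ hs v 1
  have h := integral_mul_sq_le hp hg hhg hL0 (memLp_correlation_iteratedDeriv hψ hs v 1).neg hd
  rw [iteratedDeriv_zero] at h hc0
  rw [inner_mulL, sq_norm_eq_integral, sq_norm_eq_integral]
  convert h using 1
  · refine integral_congr_ae ?_
    filter_upwards [hc0] with x hx
    rw [hx]; ring
  · congr 1
    · refine integral_congr_ae ?_
      filter_upwards [hc1] with x hx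
      rw [hx]; simp
    · congr 1
      refine integral_congr_ae ?_
      filter_upwards [hc0] with x hx
      rw [hx]

/-- A bound for the rate of change of the squared norm, continuous on `L²`. -/
noncomputable def rateBound (K : ℝ) {h : ℝ → ℝ} (hh : MemLp h ⊤ volume) (v w : H) : ℝ :=
  2 * (K * ‖v‖ ^ 2 - ⟪mulL hh v, v⟫ + ⟪v, w⟫)

theorem continuous_rateBound (K : ℝ) {h : ℝ → ℝ} (hh : MemLp h ⊤ volume) :
    Continuous fun x : H × H => rateBound K hh x.1 x.2 := by
  unfold rateBound
  fun_prop

theorem norm_rateBound_le (K : ℝ) {h : ℝ → ℝ} (hh : MemLp h ⊤ volume) {v w v' w' : H}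
    (hv : ‖v'‖ ≤ ‖v‖) (hw : ‖w'‖ ≤ ‖w‖) :
    ‖rateBound K hh v' w'‖ ≤ 2 * (|K| * ‖v‖ ^ 2 + ‖mulL hh‖ * ‖v‖ * ‖v‖ + ‖v‖ * ‖w‖) := by
  simp only [rateBound, norm_mul, Real.norm_two]
  gcongr
  refine (norm_add_le _ _).trans (add_le_add ((norm_sub_le _ _).trans (add_le_add ?_ ?_)) ?_)
  · rw [norm_mul, Real.norm_eq_abs K, norm_pow, norm_norm]
    gcongr
  · refine (norm_inner_le_norm _ _).trans ?_
    gcongr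
    exact (mulL hh).le_opNorm_of_le hv
  · refine (norm_inner_le_norm _ _).trans ?_
    gcongr

/-- The dissipation is traded for the potential `h` here, so that no derivative of the mollified
solution is left when the kernel is sent to a point mass. -/
theorem sq_norm_mollify_sub_le (h0 : MemLp lam0 ⊤ volume) (h1 : MemLp lam ⊤ volume)
    (hu : Continuous u) (hsol : IsSolution τ lam0 lam u₀ u) {p : ℝ} (hp : 1 ≤ p) {g h : ℝ → ℝ}
    (hg : MemLp g (ENNReal.ofReal p) volume) (hh : MemLp h ⊤ volume) (hhg : ∀ᵐ x, h x ≤ g x)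
    {ψ : ℝ → ℝ} (hψ : ContDiff ℝ ∞ ψ) (hs : HasCompactSupport ψ) {r t : ℝ} (hr : 0 ≤ r)
    (hrt : r ≤ t) :
    ‖mollify ψ (u t)‖ ^ 2 - ‖mollify ψ (u r)‖ ^ 2 ≤
      ∫ s in r..t, rateBound ((2 * p - 1) / (2 * p) * (2 / p) ^ (1 / (2 * p - 1)) *
        normLp p g ^ (2 * p / (2 * p - 1))) hh (mollify ψ (u s))
          (mollify ψ (source τ h0 h1 u s)) := by
  have hi := integrable_iteratedDeriv hψ hs
  have hψi : Integrable ψ := by simpa using hi 0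
  have hcm : Continuous fun s => mollify ψ (u s) := (continuous_mollify hψi).comp hu
  have hcs : Continuous fun s => mollify ψ (source τ h0 h1 u s) :=
    (continuous_mollify hψi).comp (continuous_source (τ := τ) h0 h1 hu)
  have hc1 : Continuous fun s => mollify (iteratedDeriv 1 ψ) (u s) :=
    (continuous_mollify (hi 1)).comp hu
  rw [sq_norm_mollify_sub h0 h1 hu hsol hψ hs hr hrt]
  refine intervalIntegral.integral_mono_on hrt (Continuous.intervalIntegrable (by fun_prop) _ _)
    (((continuous_rateBound _ hh).comp (hcm.prodMk hcs)).intervalIntegrable _ _) fun s _ => ?_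
  have := inner_mulL_mollify_le hp hg hh hhg hψ hs (u s)
  rw [rateBound]
  gcongr
  rw [neg_le_sub_iff_le_add]
  linarith

/-- The energy inequality for weak solutions, obtained by mollification. -/
theorem sq_norm_sub_le_integral (h0 : MemLp lam0 ⊤ volume) (h1 : MemLp lam ⊤ volume)
    (hu : Continuous u) (hsol : IsSolution τ lam0 lam u₀ u) {p : ℝ} (hp : 1 ≤ p) {g h : ℝ → ℝ}
    (hg : MemLp g (ENNReal.ofReal p) volume) (hh : MemLp h ⊤ volume) (hhg : ∀ᵐ x, h x ≤ g x)
    {r t : ℝ} (hr : 0 ≤ r) (hrt : r ≤ t) :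
    ‖u t‖ ^ 2 - ‖u r‖ ^ 2 ≤
      ∫ s in r..t, rateBound ((2 * p - 1) / (2 * p) * (2 / p) ^ (1 / (2 * p - 1)) *
        normLp p g ^ (2 * p / (2 * p - 1))) hh (u s) (source τ h0 h1 u s) := by
  have hcf := continuous_source (τ := τ) h0 h1 hu
  -- Only the outer radius `1/(n+1)` matters; half of it serves as inner radius.
  obtain ⟨b, hb⟩ : ∃ b : ℕ → ContDiffBump (0 : ℝ), Tendsto (fun n => (b n).rOut) atTop (𝓝 0) :=
    ⟨fun n => ⟨1 / (2 * ((n : ℝ) + 1)), 1 / ((n : ℝ) + 1), by positivity, by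
      apply one_div_lt_one_div_of_lt <;> nlinarith [Nat.cast_nonneg (α := ℝ) n]⟩,
      tendsto_one_div_add_atTop_nhds_zero_nat⟩
  have hR (v : H) := tendsto_mollify_normed hb v
  have hRc (n : ℕ) : Continuous (mollify ((b n).normed volume)) :=
    continuous_mollify (b n).integrable_normed
  have hRle (n : ℕ) (v : H) := norm_mollify_normed_le (b n) v
  refine le_of_tendsto_of_tendsto' (((hR (u t)).norm.pow 2).sub ((hR (u r)).norm.pow 2)) ?_
    fun n => sq_norm_mollify_sub_le h0 h1 hu hsol hp hg hh hhg (b n).contDiff_normed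
      (b n).hasCompactSupport_normed hr hrt
  refine intervalIntegral.tendsto_integral_filter_of_dominated_convergence _
    (.of_forall fun n => ?_) (.of_forall fun n => .of_forall fun s _ =>
      norm_rateBound_le _ hh (hRle n _) (hRle n _))
    (Continuous.intervalIntegrable (by fun_prop) _ _) (.of_forall fun s _ => ?_)
  · exact ((continuous_rateBound _ hh).comp (((hRc n).comp hu).prodMk
      ((hRc n).comp hcf))).aestronglyMeasurable
  · have h2 := (hR (u s)).prodMk_nhds (hR (source τ h0 h1 u s))
    have h3 := ((continuous_rateBound ((2 * p - 1) / (2 * p) * (2 / p) ^ (1 / (2 * p - 1)) *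
      normLp p g ^ (2 * p / (2 * p - 1))) hh).tendsto (u s, source τ h0 h1 u s)).comp h2
    simpa only [comp_def] using h3

end Evolution

/-! ### The memory term and the Grönwall argument. -/

/-- The memory term of the energy solves a delay differential equation. -/
theorem hasDerivAt_memory {q : ℝ → ℝ} (hq : Continuous q) (τ t : ℝ) :
    HasDerivAt (fun t => ∫ s in (t - τ)..t, Real.exp (-(t - s)) * q s)
      (-(∫ s in (t - τ)..t, Real.exp (-(t - s)) * q s) + q t - Real.exp (-τ) * q (t - τ)) t := by
  have hc : Continuous fun s => Real.exp s * q s := by fun_prop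
  -- Pulling out `e^{-t}` leaves `t` only in the limits of integration.
  have hfac (t : ℝ) : ∫ s in (t - τ)..t, Real.exp (-(t - s)) * q s = Real.exp (-t) *
      ((∫ s in (0 : ℝ)..t, Real.exp s * q s) - ∫ s in (0 : ℝ)..(t - τ), Real.exp s * q s) := by
    rw [intervalIntegral.integral_interval_sub_left (hc.intervalIntegrable _ _)
      (hc.intervalIntegrable _ _), ← intervalIntegral.integral_const_mul]
    refine intervalIntegral.integral_congr fun s _ => ?_
    rw [← mul_assoc, ← Real.exp_add]
    congr 2
    ring
  have hP (t : ℝ) : HasDerivAt (fun t => ∫ s in (0 : ℝ)..t, Real.exp s * q s)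
      (Real.exp t * q t) t :=
    intervalIntegral.integral_hasDerivAt_right (hc.intervalIntegrable _ _)
      (hc.stronglyMeasurableAtFilter _ _) hc.continuousAt
  simp only [hfac]
  have h := ((hasDerivAt_neg t).exp).mul
    ((hP t).sub ((hP (t - τ)).comp_sub_const t τ))
  refine h.congr_deriv ?_
  have e1 : Real.exp (-t) * Real.exp t = 1 := by rw [← Real.exp_add]; simp
  have e2 : Real.exp (-t) * Real.exp (t - τ) = Real.exp (-τ) := by
    rw [← Real.exp_add]; congr 1; ring
  simp only [Pi.sub_apply]
  linear_combination q t * e1 - q (t - τ) * e2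

/-- Exponential decay of the Lyapunov functional from the integrated energy inequality. -/
theorem lyapunov_decay {τ δ : ℝ} (hτ : 0 ≤ τ) {A q : ℝ → ℝ} (hA : Continuous A)
    (hq : Continuous q) (hA0 : ∀ t, 0 ≤ A t) (hq0 : ∀ t, 0 ≤ q t)
    (hle : ∀ r t, 0 ≤ r → r ≤ t →
      A t - A r ≤ ∫ s in r..t, (-(2 * δ) * A s - q s + Real.exp (-τ) * q (s - τ)))
    {t : ℝ} (ht : 0 ≤ t) :
    1 / 2 * A t + 1 / 2 * ∫ s in (t - τ)..t, Real.exp (-(t - s)) * q s ≤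
      (1 / 2 * A 0 + 1 / 2 * ∫ s in (0 - τ)..0, Real.exp (-(0 - s)) * q s) *
        Real.exp (-min (2 * δ) 1 * t) := by
  set m : ℝ → ℝ := fun t => ∫ s in (t - τ)..t, Real.exp (-(t - s)) * q s with hm
  have hm0 (t : ℝ) : 0 ≤ m t :=
    intervalIntegral.integral_nonneg (by linarith) fun s _ => mul_nonneg (Real.exp_nonneg _) (hq0 s)
  have hmd (t : ℝ) : HasDerivAt m (-m t + q t - Real.exp (-τ) * q (t - τ)) t :=
    hasDerivAt_memory hq τ t
  have hmc : Continuous m := continuous_iff_continuousAt.2 fun t => (hmd t).continuousAt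
  set D : ℝ → ℝ := fun s => -(2 * δ) * A s - q s + Real.exp (-τ) * q (s - τ) with hD
  have hDc : Continuous D := by fun_prop
  -- `A` need not be differentiable. Its increments from `x` are dominated by those of this
  -- differentiable majorant, in whose derivative all `q` terms cancel; this bounds the lower right
  -- Dini derivative needed for Grönwall.
  have hΨ (x : ℝ) : HasDerivAt (fun z => 1 / 2 * (∫ s in x..z, D s) + 1 / 2 * m z)
      (-δ * A x - 1 / 2 * m x) x := by
    have h := ((intervalIntegral.integral_hasDerivAt_right (hDc.intervalIntegrable x x)
      (hDc.stronglyMeasurableAtFilter _ _) hDc.continuousAt).const_mul (1 / 2)).add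
        ((hmd x).const_mul (1 / 2))
    refine h.congr_deriv ?_
    simp only [hD]
    ring
  have h := le_gronwallBound_of_liminf_deriv_right_le
    (f := fun t => 1 / 2 * A t + 1 / 2 * m t) (f' := fun x => -δ * A x - 1 / 2 * m x)
    (δ := 1 / 2 * A 0 + 1 / 2 * m 0) (K := -min (2 * δ) 1) (ε := 0) (a := 0) (b := t)
    (by fun_prop) (fun x hx r hr => ?_) le_rfl (fun x _ => ?_) t ⟨ht, le_rfl⟩
  · simpa only [gronwallBound_ε0, sub_zero] using h
  · have hev := (hΨ x).hasDerivWithinAt.limsup_slope_le' (s := Ioi x) (by simp) hr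
    refine Eventually.frequently ?_
    filter_upwards [hev, self_mem_nhdsWithin] with z hz hxz
    refine lt_of_le_of_lt ?_ hz
    rw [slope_def_field, div_eq_inv_mul (_ - _)]
    have hxz' : x < z := hxz
    have := hle x z hx.1 hxz'.le
    have hpos : 0 ≤ (z - x)⁻¹ := inv_nonneg.2 (by linarith)
    refine mul_le_mul_of_nonneg_left ?_ hpos
    simp only [intervalIntegral.integral_same]
    linarith
  · have h1 : min (2 * δ) 1 * A x ≤ 2 * δ * A x :=
      mul_le_mul_of_nonneg_right (min_le_left _ _) (hA0 x)
    have h2 : min (2 * δ) 1 * m x ≤ 1 * m x :=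
      mul_le_mul_of_nonneg_right (min_le_right _ _) (hm0 x)
    linarith

/-! ### Energy decay and its comparison with the initial data. -/

section Stability

variable {τ : ℝ} {lam0 lam : ℝ → ℝ} {u₀ u : ℝ → H}

theorem energy_eq (hl : MemLp (fun x => |lam x|) ⊤ volume) (u : ℝ → H) (t : ℝ) :
    energy τ lam u t = 1 / 2 * ‖u t‖ ^ 2 +
      1 / 2 * ∫ s in (t - τ)..t, Real.exp (-(t - s)) * ⟪mulL hl (u s), u s⟫ := by
  rw [energy, sq_norm_eq_integral]
  congr 2
  refine intervalIntegral.integral_congr fun s _ => ?_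
  simp only [inner_mulL, ← integral_const_mul]
  refine integral_congr_ae (.of_forall fun x => ?_)
  simp only
  ring

theorem inner_mulL_abs_nonneg (hl : MemLp (fun x => |lam x|) ⊤ volume) (v : H) :
    0 ≤ ⟪mulL hl v, v⟫ := by
  rw [inner_mulL]
  refine integral_nonneg fun x => ?_
  rw [Pi.zero_apply, mul_assoc]
  exact mul_nonneg (abs_nonneg _) (mul_self_nonneg _)

/-- The `lam0` terms cancel. Young turns the delay term into `e^τ ⟪|lam| v, v⟫` plus the delayed
term; against the `e^τ + 1` in `h` this leaves exactly `-⟪|lam| v, v⟫`, which the memory term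
balances. -/
theorem rateBound_source_le (h0 : MemLp lam0 ⊤ volume) (h1 : MemLp lam ⊤ volume)
    (hl : MemLp (fun x => |lam x|) ⊤ volume) {κ : ℝ}
    (hh : MemLp (fun x => κ - lam0 x + (Real.exp τ + 1) / 2 * |lam x|) ⊤ volume) (K : ℝ)
    (u : ℝ → H) (s : ℝ) :
    rateBound K hh (u s) (source τ h0 h1 u s) ≤
      -(2 * (κ - K)) * ‖u s‖ ^ 2 - ⟪mulL hl (u s), u s⟫ +
        Real.exp (-τ) * ⟪mulL hl (u (s - τ)), u (s - τ)⟫ := by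
  set v := u s
  set w := u (s - τ)
  have hv2 : Integrable fun x => v x ^ 2 := (Lp.memLp v).integrable_sq
  have i0 := integrable_mulL h0 v v
  have iw := integrable_mulL h1 w v
  have ilv := integrable_mulL hl v v
  have ilw := integrable_mulL hl w w
  have hhv : ⟪mulL hh v, v⟫ = κ * ‖v‖ ^ 2 - ⟪mulL h0 v, v⟫ +
      (Real.exp τ + 1) / 2 * ⟪mulL hl v, v⟫ := by
    have i1 : Integrable fun x => κ * v x ^ 2 - lam0 x * v x * v x := (hv2.const_mul κ).sub i0
    rw [inner_mulL, inner_mulL, inner_mulL, sq_norm_eq_integral, ← integral_const_mul,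
      ← integral_const_mul, ← integral_sub (hv2.const_mul κ) i0,
      ← integral_add i1 (ilv.const_mul _)]
    refine integral_congr_ae (.of_forall fun x => ?_)
    ring
  have hyoung : -⟪mulL h1 w, v⟫ ≤
      Real.exp τ / 2 * ⟪mulL hl v, v⟫ + Real.exp (-τ) / 2 * ⟪mulL hl w, w⟫ := by
    rw [inner_mulL, inner_mulL, inner_mulL, ← integral_const_mul, ← integral_const_mul,
      ← integral_add (ilv.const_mul _) (ilw.const_mul _), ← integral_neg]
    refine integral_mono iw.neg ((ilv.const_mul _).add (ilw.const_mul _)) fun x => ?_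
    have he : Real.exp τ * Real.exp (-τ) = 1 := by rw [← Real.exp_add]; simp
    have hsq : |w x| * |v x| ≤ Real.exp τ / 2 * v x ^ 2 + Real.exp (-τ) / 2 * w x ^ 2 := by
      have h2 : 0 ≤ Real.exp (-τ) / 2 * (Real.exp τ * |v x| - |w x|) ^ 2 := by positivity
      have hv' := sq_abs (v x)
      have hw' := sq_abs (w x)
      have : Real.exp (-τ) / 2 * (Real.exp τ * |v x| - |w x|) ^ 2 =
          Real.exp τ / 2 * v x ^ 2 + Real.exp (-τ) / 2 * w x ^ 2 - |w x| * |v x| := by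
        rw [← hv', ← hw']
        linear_combination (Real.exp τ / 2 * |v x| ^ 2 - |v x| * |w x|) * he
      linarith
    calc -(lam x * w x * v x) ≤ |lam x * w x * v x| := neg_le_abs _
      _ = |lam x| * (|w x| * |v x|) := by rw [abs_mul, abs_mul, mul_assoc]
      _ ≤ |lam x| * (Real.exp τ / 2 * v x ^ 2 + Real.exp (-τ) / 2 * w x ^ 2) := by gcongr
      _ = _ := by ring
  rw [rateBound, hhv, source, inner_sub_right, inner_neg_right, real_inner_comm,
    real_inner_comm (mulL h1 w)]
  linarith

theorem energy_decay_of_continuous (hτ : 0 ≤ τ) (h0 : MemLp lam0 ⊤ volume)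
    (h1 : MemLp lam ⊤ volume) {p : ℝ} (hp : 1 ≤ p) {α₀ α : ℝ} {β₀ β : ℝ → ℝ}
    (hβ₀ : MemLp β₀ (ENNReal.ofReal p) volume) (hβ : MemLp β (ENNReal.ofReal p) volume)
    (h_lam0 : ∀ᵐ x : ℝ, α₀ - β₀ x ≤ lam0 x)
    (h_lam : ∀ᵐ x : ℝ, (Real.exp τ + 1) / 2 * |lam x| ≤ α + β x)
    (hu : Continuous u) (hsol : IsSolution τ lam0 lam u₀ u) {t : ℝ} (ht : 0 ≤ t) :
    energy τ lam u t ≤ energy τ lam u 0 * Real.exp (-rate p α₀ α β₀ β * t) := by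
  have hl : MemLp (fun x => |lam x|) ⊤ volume := h1.norm
  -- In the factor `(e^τ+1)/2`, `e^τ/2` pays for Young's inequality and `1/2` for the memory term;
  -- adding the two pointwise hypotheses gives the bound by `β + β₀`.
  have hh : MemLp (fun x => (α₀ - α) - lam0 x + (Real.exp τ + 1) / 2 * |lam x|) ⊤ volume :=
    ((memLp_top_const _).sub h0).add (hl.const_mul _)
  have hhg : ∀ᵐ x, (α₀ - α) - lam0 x + (Real.exp τ + 1) / 2 * |lam x| ≤ (β + β₀) x := by
    filter_upwards [h_lam0, h_lam] with x hx0 hx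
    rw [Pi.add_apply]
    linarith
  have hq : Continuous fun s => ⟪mulL hl (u s), u s⟫ := by fun_prop
  rw [energy_eq hl, energy_eq hl, rate]
  refine lyapunov_decay hτ (hu.norm.pow 2) hq (fun t => sq_nonneg _)
    (fun t => inner_mulL_abs_nonneg hl _) (fun r t hr hrt => ?_) ht
  refine (sq_norm_sub_le_integral h0 h1 hu hsol hp (hβ.add hβ₀) hh hhg hr hrt).trans ?_
  have hcs := continuous_source (τ := τ) h0 h1 hu
  refine intervalIntegral.integral_mono_on hrt
    (((continuous_rateBound _ hh).comp (hu.prodMk hcs)).intervalIntegrable _ _)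
    (Continuous.intervalIntegrable (by fun_prop) _ _) fun s _ => ?_
  exact rateBound_source_le h0 h1 hl hh _ u s

/-- Freezing `u` at its value at `-τ` for earlier times makes it continuous on all of `ℝ` without
affecting the equation. -/
theorem IsSolution.exists_continuous (hτ : 0 ≤ τ) (hsol : IsSolution τ lam0 lam u₀ u) :
    ∃ w : ℝ → H, Continuous w ∧ IsSolution τ lam0 lam u₀ w ∧ ∀ s, -τ ≤ s → w s = u s := by
  have heq (s : ℝ) (hs : -τ ≤ s) : u (max s (-τ)) = u s := by rw [max_eq_left hs]
  have hc : Continuous fun s => u (max s (-τ)) :=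
    hsol.continuousOn.comp_continuous (by fun_prop) fun s => mem_Ici.2 (le_max_right _ _)
  refine ⟨fun s => u (max s (-τ)), hc, ⟨hc.continuousOn, fun s hs => ?_, fun φ hφ hφs t ht => ?_⟩,
    heq⟩
  · rw [heq s hs.1, hsol.history s hs]
  · rw [heq t (by linarith), heq 0 (by linarith), hsol.weak φ hφ hφs t ht]
    congr 1
    refine intervalIntegral.integral_congr fun s hs => ?_
    rw [uIcc_of_le ht] at hs
    rw [heq s (by linarith [hs.1]), heq (s - τ) (by linarith [hs.1])]

theorem energy_congr {w : ℝ → H} (hτ : 0 ≤ τ) (h : ∀ s, -τ ≤ s → w s = u s) {t : ℝ} (ht : 0 ≤ t) :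
    energy τ lam w t = energy τ lam u t := by
  rw [energy, energy, h t (by linarith)]
  congr 2
  refine intervalIntegral.integral_congr fun s hs => ?_
  rw [uIcc_of_le (by linarith)] at hs
  rw [h s (by linarith [hs.1])]

theorem memory_nonneg (hτ : 0 ≤ τ) (hl : MemLp (fun x => |lam x|) ⊤ volume) (u : ℝ → H) (t : ℝ) :
    0 ≤ ∫ s in (t - τ)..t, Real.exp (-(t - s)) * ⟪mulL hl (u s), u s⟫ :=
  intervalIntegral.integral_nonneg (by linarith) fun s _ =>
    mul_nonneg (Real.exp_nonneg _) (inner_mulL_abs_nonneg hl _)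

/-- `initConst` carries the full memory integral, the energy only half of it. -/
theorem energy_zero_le_initConst (hτ : 0 ≤ τ) (h1 : MemLp lam ⊤ volume)
    (hsol : IsSolution τ lam0 lam u₀ u) : energy τ lam u 0 ≤ initConst τ lam u₀ := by
  have hl : MemLp (fun x => |lam x|) ⊤ volume := h1.norm
  have hm := memory_nonneg hτ hl u 0
  have he : ∫ s in (0 - τ)..0, Real.exp (-(0 - s)) * ⟪mulL hl (u s), u s⟫ =
      ∫ s in (-τ)..0, Real.exp s * ∫ x, |lam x| * (u₀ s x) ^ 2 := by
    rw [zero_sub]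
    refine intervalIntegral.integral_congr fun s hs => ?_
    rw [uIcc_of_le (by linarith)] at hs
    simp only [zero_sub, neg_neg, inner_mulL, hsol.history s hs, mul_assoc, pow_two]
  rw [energy_eq hl, initConst, ← he, hsol.history 0 ⟨by linarith, le_rfl⟩]
  linarith

theorem energy_zero_le_sup (hτ : 0 ≤ τ) (hl : MemLp (fun x => |lam x|) ⊤ volume)
    (hu₀ : ContinuousOn u₀ (Icc (-τ) 0)) (hsol : IsSolution τ lam0 lam u₀ u) :
    2 * energy τ lam u 0 ≤ (1 + τ * ‖mulL hl‖) * (⨆ s : Icc (-τ) (0 : ℝ), ‖u₀ s‖) ^ 2 := by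
  set N := ⨆ s : Icc (-τ) (0 : ℝ), ‖u₀ s‖
  have hbdd : BddAbove (range fun s : Icc (-τ) (0 : ℝ) => ‖u₀ s‖) := by
    have h := (isCompact_Icc.image_of_continuousOn hu₀.norm).bddAbove
    rwa [image_eq_range] at h
  have hN (s : ℝ) (hs : s ∈ Icc (-τ) 0) : ‖u s‖ ≤ N := by
    rw [hsol.history s hs]
    exact le_ciSup hbdd ⟨s, hs⟩
  have h0 : ‖u 0‖ ^ 2 ≤ N ^ 2 := by
    gcongr
    exact hN 0 ⟨by linarith, le_rfl⟩
  have hm : ∫ s in (0 - τ)..0, Real.exp (-(0 - s)) * ⟪mulL hl (u s), u s⟫ ≤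
      ‖mulL hl‖ * N ^ 2 * |0 - (0 - τ)| := by
    refine (Real.le_norm_self _).trans (intervalIntegral.norm_integral_le_of_norm_le_const ?_)
    intro s hs
    rw [uIoc_of_le (by linarith), zero_sub] at hs
    have hs' : s ∈ Icc (-τ) 0 := ⟨hs.1.le, hs.2⟩
    rw [norm_mul, Real.norm_of_nonneg (Real.exp_nonneg _)]
    have hexp : Real.exp (-(0 - s)) ≤ 1 := Real.exp_le_one_iff.2 (by linarith [hs.2])
    have hin : ‖⟪mulL hl (u s), u s⟫‖ ≤ ‖mulL hl‖ * N ^ 2 := by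
      refine (norm_inner_le_norm _ _).trans ?_
      calc ‖mulL hl (u s)‖ * ‖u s‖ ≤ ‖mulL hl‖ * N * N := by
            gcongr
            · exact (norm_nonneg _).trans ((mulL hl).le_opNorm_of_le (hN s hs'))
            · exact (mulL hl).le_opNorm_of_le (hN s hs')
            · exact hN s hs'
        _ = _ := by ring
    calc _ ≤ 1 * (‖mulL hl‖ * N ^ 2) := by gcongr
      _ = _ := one_mul _
  rw [energy_eq hl]
  rw [sub_sub_cancel, abs_of_nonneg hτ] at hm
  linarith

end Stability

/-- Raising the smallness condition to the power `2p/(2p-1)` makes it linear in `α₀ - α`. -/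
theorem rate_pos {p α₀ α : ℝ} (hp : 1 ≤ p) (hα : α < α₀) {β₀ β : ℝ → ℝ}
    (h : normLp p (β₀ + β) < ((α₀ - α) / c p) ^ (1 - 1 / (2 * p))) : 0 < rate p α₀ α β₀ β := by
  have h2p : 0 < 2 * p - 1 := by linarith
  have e : 1 - 1 / (2 * p) = (2 * p - 1) / (2 * p) := by field_simp
  have hc : 0 < c p := by
    rw [c, e]
    positivity
  have hG : 0 ≤ normLp p (β₀ + β) := ENNReal.toReal_nonneg
  have hpow := Real.rpow_lt_rpow hG h (z := 2 * p / (2 * p - 1)) (by positivity)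
  rw [← Real.rpow_mul (div_nonneg (by linarith) hc.le), e,
    show (2 * p - 1) / (2 * p) * (2 * p / (2 * p - 1)) = 1 by field_simp, Real.rpow_one,
    lt_div_iff₀ hc, c, e, add_comm β₀] at hpow
  rw [rate, lt_min_iff]
  exact ⟨by linarith, one_pos⟩

end KdVB

theorem theorem4p1 (τ : ℝ) (hτ : 0 < τ) (lam0 lam : ℝ → ℝ)
    (hlam0 : MemLp lam0 ∞ volume) (hlam : MemLp lam ∞ volume)
    (p : ℝ) (hp : 1 ≤ p) (α₀ α : ℝ) (β₀ β : ℝ → ℝ)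
    (hβ₀ : MemLp β₀ (ENNReal.ofReal p) volume) (hβ : MemLp β (ENNReal.ofReal p) volume)
    (hα₀ : 0 < α₀)
    (h_lam0 : ∀ᵐ x : ℝ, α₀ - β₀ x ≤ lam0 x)
    (h_norm_β₀ : KdVB.normLp p β₀ < (α₀ / KdVB.c p) ^ (1 - 1 / (2 * p)))
    (h_lam : ∀ᵐ x : ℝ, (Real.exp τ + 1) / 2 * |lam x| ≤ α + β x)
    (hα : 0 ≤ α) (hαα₀ : α < α₀)
    (h_norm : KdVB.normLp p (β₀ + β) < ((α₀ - α) / KdVB.c p) ^ (1 - 1 / (2 * p))) :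
    KdVB.ExponentiallyStable τ lam0 lam ∧
      0 < KdVB.rate p α₀ α β₀ β ∧
      ∀ u₀ u : ℝ → KdVB.H, ContinuousOn u₀ (Icc (-τ) 0) →
        KdVB.IsSolution τ lam0 lam u₀ u → ∀ t : ℝ, 0 ≤ t →
          KdVB.energy τ lam u t ≤
              KdVB.energy τ lam u 0 * Real.exp (-KdVB.rate p α₀ α β₀ β * t) ∧
            KdVB.energy τ lam u t ≤
              KdVB.initConst τ lam u₀ * Real.exp (-KdVB.rate p α₀ α β₀ β * t) := by
  have hrate := KdVB.rate_pos hp hαα₀ h_norm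
  have hl : MemLp (fun x => |lam x|) ⊤ volume := hlam.norm
  have hdecay (u₀ u : ℝ → KdVB.H) (hsol : KdVB.IsSolution τ lam0 lam u₀ u) (t : ℝ) (ht : 0 ≤ t) :
      KdVB.energy τ lam u t ≤
        KdVB.energy τ lam u 0 * Real.exp (-KdVB.rate p α₀ α β₀ β * t) := by
    obtain ⟨w, hw, hwsol, hwu⟩ := hsol.exists_continuous hτ.le
    rw [← KdVB.energy_congr hτ.le hwu ht, ← KdVB.energy_congr hτ.le hwu le_rfl]
    exact KdVB.energy_decay_of_continuous hτ.le hlam0 hlam hp hβ₀ hβ h_lam0 h_lam hw hwsol ht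
  -- The norm is controlled by the square root of twice the energy: hence half the rate, and the
  -- root of the constant in `energy_zero_le_sup`.
  refine ⟨⟨Real.sqrt (1 + τ * ‖KdVB.mulL hl‖), KdVB.rate p α₀ α β₀ β / 2, by positivity,
    half_pos hrate, fun u₀ u hu₀ hsol t ht => ?_⟩, hrate, fun u₀ u _ hsol t ht =>
    ⟨hdecay u₀ u hsol t ht, (hdecay u₀ u hsol t ht).trans ?_⟩⟩
  · have hN : 0 ≤ ⨆ s : Icc (-τ) (0 : ℝ), ‖u₀ s‖ := Real.iSup_nonneg fun s => norm_nonneg _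
    refine le_of_sq_le_sq ?_ (by positivity)
    have h1 : ‖u t‖ ^ 2 ≤ 2 * KdVB.energy τ lam u t := by
      rw [KdVB.energy_eq hl]
      linarith [KdVB.memory_nonneg hτ.le hl u t]
    have hexp : Real.exp (-(KdVB.rate p α₀ α β₀ β / 2) * t) ^ 2 =
        Real.exp (-KdVB.rate p α₀ α β₀ β * t) := by
      rw [pow_two, ← Real.exp_add]
      congr 1
      ring
    rw [mul_pow, mul_pow, Real.sq_sqrt (by positivity), hexp]
    have h2 := mul_le_mul_of_nonneg_right (KdVB.energy_zero_le_sup hτ.le hl hu₀ hsol)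
      (Real.exp_nonneg (-KdVB.rate p α₀ α β₀ β * t))
    linarith [hdecay u₀ u hsol t ht]
  · gcongr
    exact KdVB.energy_zero_le_initConst hτ.le hlam hsol
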